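/- Let $N\ge 1$ agents communicate over an undirected connected graph with (nonnegative, symmetric) edge weights and Laplacian $L\in\mathbb R^{N\times N}$, and put $\boldsymbol L=L\otimes I_n$. Let $f_i:\mathbb R^n\to\mathbb R$, $i=1,\dots,N$, be differentiable, and for $x=(x_1,\dots,x_N)\in\mathbb R^{Nn}$ let $f(x)=\sum_{i=1}^N f_i(x_i)$. Assume: (a) $f$ is convex, i.e. $(\nabla f(x)-\nabla f(y))^\top(x-y)\ge 0$ for all $x,y\in\mathbb R^{Nn}$; (b) for some $l>0$, $(\nabla f(x)-\nabla f(y))^\top(x-y)\le l\|x-y\|^2$ for all $x,y\in\mathbb R^{Nn}$; (c) the problem $\min_{x\in\mathbb R^{Nn}} \sum_{i=1}^N f_i(x_i)$ subject to $\boldsymbol L x=0$ has an optimal solution. Let $Q\in\mathbb R^{N\times N}$ be an orthogonal matrix one of whose columns, with index $s$, is $\tfrac1{\sqrt N}\mathbf 1_N$; write $x=(Q\otimes I_n)x'$ and $g(x')=f((Q\otimes I_n)x')$. Consider the condition that $f$ is *partially strongly convex on the subspace satisfying the constraint*: there is $\mu>0$ with $$(\nabla g(x')-\nabla g(y'))^\top(x'-y')\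 \ge\ \mu\,\|x'_s-y'_s\|^2$$ for all $x',y'\in\mathbb R^{Nn}$ with $\boldsymbol L(Q\otimes I_n)x'=0=\boldsymbol L(Q\otimes I_n)y'$, where $x'_s\in\mathbb R^n$ is the $s$-th block of $x'$. Then: 1. This condition holds if and only if the sum $u\mapsto\sum_{i=1}^N f_i(u)$ is strongly convex on $\mathbb R^n$ (with some modulus $m>0$). 2. If it holds and $\alpha>0$, then the problem in (c) has exactly one optimal solution $x^*$, there is a $\lambda^*$ with $\nabla f(x^*)+\boldsymbol L\lambda^*=0$, and the variable $x(t)$ of the distributed proportional-integral primal-dual flow $$\dot x=-\nabla f(x)-\alpha\boldsymbol L x-\boldsymbol L\lambda,\qquad \dot\lambda=\boldsymbol L x$$ converges globally exponentially to $x^*$: there are constants $c\ge 0$ and $\rho>0$ such that for every solution $(x(t),\lambda(t))$, $t\ge 0$, of the flow, every $\lambda^*$ with $\nabla f(x^*)+\boldsymbol L\lambda^*=0$ and all $t\ge 0$, $$\|x(t)-x^*\|\ \le\ c\,e^{-\rho t}\,\sqrt{\|x(0)-x^*\|^2+\|\lambda(0)-\lambda^*\|^2}.$$ -/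

import Mathlib

open scoped Gradient InnerProductSpace Kronecker Matrix

noncomputable section

/-- Stacked vectors `x = (x_1, …, x_N)` of `N` blocks `x_i ∈ ℝⁿ`, i.e. elements of the Euclidean
space `ℝ^{Nn}`; the coordinate `(i, a)` is the `a`-th coordinate of the block `x_i`. -/
abbrev Stack (N n : ℕ) : Type := EuclideanSpace ℝ (Fin N × Fin n)

/-- The block `x_i ∈ ℝⁿ` of a stacked vector. -/
def block {N n : ℕ} (x : Stack N n) (i : Fin N) : EuclideanSpace ℝ (Fin n) :=
  WithLp.toLp 2 fun a => x (i, a)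

/-- An undirected communication graph on `N` agents, with nonnegative edge weights
(`weight i j > 0` exactly when `i` and `j` communicate). -/
structure CommGraph (N : ℕ) where
  weight : Fin N → Fin N → ℝ
  nonneg : ∀ i j, 0 ≤ weight i j
  symm : ∀ i j, weight i j = weight j i
  loopless : ∀ i, weight i i = 0

namespace CommGraph

variable {N : ℕ}

/-- The underlying simple graph: an edge wherever the weight is positive. -/
def toSimpleGraph (G : CommGraph N) : SimpleGraph (Fin N) where
  Adj i j := 0 < G.weight i j
  symm := ⟨fun i j h => by rw [G.symm j i]; exact h⟩
  loopless := ⟨fun i h => by rw [G.loopless i] at h; exact lt_irrefl _ h⟩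

/-- The Laplacian matrix: degree matrix minus adjacency matrix. -/
def laplacian (G : CommGraph N) : Matrix (Fin N) (Fin N) ℝ :=
  Matrix.diagonal (fun i => ∑ j, G.weight i j) - Matrix.of G.weight

end CommGraph

/-- `(M ⊗ I_n) x`. -/
def kronId {N n : ℕ} (M : Matrix (Fin N) (Fin N) ℝ) (x : Stack N n) : Stack N n :=
  WithLp.toLp 2 ((M ⊗ₖ (1 : Matrix (Fin n) (Fin n) ℝ)) *ᵥ x.ofLp)

/-- The separable cost `f(x) = ∑ i, f_i(x_i)` of a stacked vector. -/
def stackedCost {N n : ℕ} (f : Fin N → EuclideanSpace ℝ (Fin n) → ℝ) (x : Stack N n) : ℝ :=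
  ∑ i, f i (block x i)

/-- The global cost `u ↦ ∑ i, f_i(u)` on `ℝⁿ`. -/
def globalCost {N n : ℕ} (f : Fin N → EuclideanSpace ℝ (Fin n) → ℝ)
    (u : EuclideanSpace ℝ (Fin n)) : ℝ :=
  ∑ i, f i u

/-- `x` solves: minimize `∑ i, f_i(x_i)` subject to `(L ⊗ I_n) x = 0`. -/
def IsOptimalSolution {N n : ℕ} (G : CommGraph N)
    (f : Fin N → EuclideanSpace ℝ (Fin n) → ℝ) (x : Stack N n) : Prop :=
  kronId G.laplacian x = 0 ∧
    ∀ y : Stack N n, kronId G.laplacian y = 0 → stackedCost f x ≤ stackedCost f y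

/-- Convexity of a differentiable function: its gradient is monotone. -/
def GradMonotone {N n : ℕ} (F : Stack N n → ℝ) : Prop :=
  ∀ x y : Stack N n, 0 ≤ ⟪∇ F x - ∇ F y, x - y⟫_ℝ

/-- `l`-smoothness of a differentiable function, in gradient form. -/
def GradUpperBound {N n : ℕ} (l : ℝ) (F : Stack N n → ℝ) : Prop :=
  ∀ x y : Stack N n, ⟪∇ F x - ∇ F y, x - y⟫_ℝ ≤ l * ‖x - y‖ ^ 2

/-- `g` is `μ`-partially strongly convex on `D` with respect to the block `x_s`:
`(∇g(x) - ∇g(y))ᵀ(x - y) ≥ μ ‖x_s - y_s‖²` for all `x, y ∈ D`. -/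
def PartiallyStronglyConvexOn {N n : ℕ} (D : Set (Stack N n)) (s : Fin N) (μ : ℝ)
    (g : Stack N n → ℝ) : Prop :=
  ∀ x ∈ D, ∀ y ∈ D, μ * ‖block x s - block y s‖ ^ 2 ≤ ⟪∇ g x - ∇ g y, x - y⟫_ℝ

/-- `Q` is an orthogonal `N × N` matrix whose column `s` is the normalized consensus vector
`1_N / √N`. -/
def IsConsensusTransform {N : ℕ} (Q : Matrix (Fin N) (Fin N) ℝ) (s : Fin N) : Prop :=
  Q ∈ Matrix.orthogonalGroup (Fin N) ℝ ∧ ∀ i, Q i s = 1 / Real.sqrt N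

/-- Partial strong convexity of the constrained problem. In the coordinates `x = (Q ⊗ I_n) x'`,
the function `g(x') = f((Q ⊗ I_n) x')` is `μ`-partially strongly convex with respect to the block
`x'_s` (the one that the constraint leaves free), within the subspace of those `x'` that satisfy
the equality constraint `(L ⊗ I_n)(Q ⊗ I_n) x' = 0`. -/
def ConsensusPartiallyStronglyConvex {N n : ℕ} (G : CommGraph N)
    (Q : Matrix (Fin N) (Fin N) ℝ) (s : Fin N) (μ : ℝ)
    (f : Fin N → EuclideanSpace ℝ (Fin n) → ℝ) : Prop :=
  PartiallyStronglyConvexOn {x' : Stack N n | kronId G.laplacian (kronId Q x') = 0} s μ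
    (fun x' : Stack N n => stackedCost f (kronId Q x'))

/-- `(x, lam)` solves on `[0, ∞)` the distributed proportional-integral primal-dual flow
`ẋ = -∇f(x) - α (L ⊗ I_n) x - (L ⊗ I_n) lam`, `lam' = (L ⊗ I_n) x`. -/
def IsPIFlow {N n : ℕ} (G : CommGraph N) (α : ℝ)
    (f : Fin N → EuclideanSpace ℝ (Fin n) → ℝ) (x lam : ℝ → Stack N n) : Prop :=
  ∀ t : ℝ, 0 ≤ t →
    HasDerivWithinAt x
      (-∇ (stackedCost f) (x t) - α • kronId G.laplacian (x t) - kronId G.laplacian (lam t))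
      (Set.Ici 0) t ∧
    HasDerivWithinAt lam (kronId G.laplacian (x t)) (Set.Ici 0) t

/-- `(xs, lams)` is an equilibrium of the flow (a KKT pair of the problem). -/
def IsEquilibrium {N n : ℕ} (G : CommGraph N)
    (f : Fin N → EuclideanSpace ℝ (Fin n) → ℝ) (xs lams : Stack N n) : Prop :=
  kronId G.laplacian xs = 0 ∧ ∇ (stackedCost f) xs + kronId G.laplacian lams = 0

end

/-! On a connected graph the kernel of `L ⊗ I_n` consists of the consensus vectors `1 ⊗ u`. If `Q x'
= 1 ⊗ u`, then `x'_s = √N u` carries the whole norm of `x'`. So partial strong convexity is strong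
monotonicity of `∇f` on this kernel; since `‖1 ⊗ u‖² = N ‖u‖²`, it is strong convexity of the global
cost with modulus `N μ`.

At an optimum the gradient is orthogonal to the kernel. This yields uniqueness, and also the
multiplier, because the range of a symmetric map is the orthogonal complement of its kernel.

For the flow, `f` need not be strongly convex off the kernel, but there the proportional term is
coercive; the Lipschitz bound on `∇f` controls the mixed terms (`exists_proportional_coercive`).
This damps the primal error only. A small cross term in the Lyapunov function also damps the dual
error, once its undetermined kernel component has been projected away
(`exists_exponential_bound_flow`). -/

/-! ### Gradient inequalities for convex and smooth functions -/

section GradientInequalities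

variable {E : Type*} [NormedAddCommGroup E] [InnerProductSpace ℝ E] [CompleteSpace E]

theorem hasDerivAt_comp_line {F : E → ℝ} (hF : Differentiable ℝ F) (x d : E) (t : ℝ) :
    HasDerivAt (fun t : ℝ => F (x + t • d)) ⟪∇ F (x + t • d), d⟫_ℝ t := by
  rw [inner_gradient_left]
  refine (hF (x + t • d)).hasFDerivAt.comp_hasDerivAt t ?_
  simpa using ((hasDerivAt_id t).smul_const d).const_add x

theorem inner_gradient_comp_clm {E' : Type*} [NormedAddCommGroup E'] [InnerProductSpace ℝ E']
    [CompleteSpace E'] {F : E → ℝ} (hF : Differentiable ℝ F) (T : E' →L[ℝ] E) (x v : E') :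
    ⟪∇ (fun y => F (T y)) x, v⟫_ℝ = ⟪∇ F (T x), T v⟫_ℝ := by
  rw [inner_gradient_left, inner_gradient_left]
  have h : HasFDerivAt (fun y => F (T y)) ((fderiv ℝ F (T x)).comp T) x :=
    (hF (T x)).hasFDerivAt.comp x T.hasFDerivAt
  rw [h.fderiv]
  rfl

/-- A strongly monotone gradient gives the quadratic lower bound (for any real modulus). -/
theorem quadratic_lower_bound_of_gradient {F : E → ℝ} (hF : Differentiable ℝ F) {m : ℝ}
    (h : ∀ x y, m * ‖x - y‖ ^ 2 ≤ ⟪∇ F x - ∇ F y, x - y⟫_ℝ) (x y : E) :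
    F x + ⟪∇ F x, y - x⟫_ℝ + m / 2 * ‖y - x‖ ^ 2 ≤ F y := by
  set d := y - x with hd
  -- The gap to the quadratic model along the segment has nonnegative derivative on `[0, 1]`;
  -- comparing its endpoints gives the claim.
  have hder : ∀ t : ℝ, HasDerivAt
      (fun t : ℝ => F (x + t • d) - t * ⟪∇ F x, d⟫_ℝ - m / 2 * ‖d‖ ^ 2 * t ^ 2)
      (⟪∇ F (x + t • d), d⟫_ℝ - ⟪∇ F x, d⟫_ℝ - m / 2 * ‖d‖ ^ 2 * (2 * t)) t := by
    intro t
    have h1 := hasDerivAt_comp_line hF x d t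
    have h2 := (hasDerivAt_id t).mul_const ⟪∇ F x, d⟫_ℝ
    have h3 := ((hasDerivAt_id t).pow 2).const_mul (m / 2 * ‖d‖ ^ 2)
    exact ((h1.sub h2).sub h3).congr_deriv (by simp)
  have hmono := monotoneOn_of_deriv_nonneg (convex_Icc (0 : ℝ) 1)
    (fun t _ => (hder t).continuousAt.continuousWithinAt)
    (fun t _ => (hder t).differentiableAt.differentiableWithinAt)
    (fun t ht => by
      rw [(hder t).deriv]
      rw [interior_Icc] at ht
      have := h (x + t • d) x
      rw [add_sub_cancel_left, inner_smul_right, norm_smul, inner_sub_left, mul_pow,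
        Real.norm_eq_abs, sq_abs] at this
      have h4 : t * (m * ‖d‖ ^ 2 * t) ≤ t * (⟪∇ F (x + t • d), d⟫_ℝ - ⟪∇ F x, d⟫_ℝ) := by
        nlinarith
      have := le_of_mul_le_mul_left h4 ht.1
      linarith)
  have := hmono (Set.left_mem_Icc.2 zero_le_one) (Set.right_mem_Icc.2 zero_le_one) zero_le_one
  have hy : x + d = y := by simp [hd]
  simp only [zero_smul, add_zero, one_smul, hy] at this
  linarith

/-- This is the lower bound for `-F` with modulus `-l`, which is why that bound allows any real
modulus. -/
theorem quadratic_upper_bound_of_gradient {F : E → ℝ} (hF : Differentiable ℝ F) {l : ℝ}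
    (h : ∀ x y, ⟪∇ F x - ∇ F y, x - y⟫_ℝ ≤ l * ‖x - y‖ ^ 2) (x y : E) :
    F y ≤ F x + ⟪∇ F x, y - x⟫_ℝ + l / 2 * ‖y - x‖ ^ 2 := by
  have hneg : ∀ x, ∇ (fun z => -F z) x = -∇ F x := by
    intro x
    refine ext_inner_right ℝ fun v => ?_
    rw [inner_neg_left, inner_gradient_left, inner_gradient_left, fderiv_fun_neg]
    rfl
  have := quadratic_lower_bound_of_gradient (F := fun z => -F z) hF.neg (m := -l)
    (fun x y => by
      rw [hneg, hneg, ← neg_sub', inner_neg_left]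
      linarith [h x y]) x y
  rw [hneg, inner_neg_left] at this
  linarith

/-- Forward: `F - m/2 ‖·‖²` is convex on each line, so its derivative there increases. Backward:
average the quadratic lower bounds taken at the convex combination. -/
theorem strongConvexOn_univ_iff_gradient {F : E → ℝ} (hF : Differentiable ℝ F) (m : ℝ) :
    StrongConvexOn Set.univ m F ↔
      ∀ x y, m * ‖x - y‖ ^ 2 ≤ ⟪∇ F x - ∇ F y, x - y⟫_ℝ := by
  constructor
  · intro h x y
    rw [strongConvexOn_iff_convex] at h
    have hder : ∀ t : ℝ, HasDerivAt
        (fun t : ℝ => F (y + t • (x - y)) - m / 2 * ‖y + t • (x - y)‖ ^ 2)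
        (⟪∇ F (y + t • (x - y)), x - y⟫_ℝ - m / 2 * (2 * ⟪y + t • (x - y), x - y⟫_ℝ)) t := by
      intro t
      have h1 : HasDerivAt (fun t : ℝ => y + t • (x - y)) (x - y) t := by
        simpa using ((hasDerivAt_id t).smul_const (x - y)).const_add y
      exact (hasDerivAt_comp_line hF y (x - y) t).sub (h1.norm_sq.const_mul (m / 2))
    have hc : ConvexOn ℝ Set.univ
        (fun t : ℝ => F (y + t • (x - y)) - m / 2 * ‖y + t • (x - y)‖ ^ 2) := by
      refine ⟨convex_univ, fun s _ t _ a b ha hb hab => ?_⟩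
      have := h.2 (Set.mem_univ (y + s • (x - y))) (Set.mem_univ (y + t • (x - y))) ha hb hab
      have e : a • (y + s • (x - y)) + b • (y + t • (x - y))
          = y + (a • s + b • t) • (x - y) := by
        have : b = 1 - a := by linarith
        subst this
        simp only [smul_eq_mul]
        module
      rwa [e] at this
    have := hc.monotoneOn_deriv (fun t _ => (hder t).differentiableAt) (Set.mem_univ 0)
      (Set.mem_univ 1) zero_le_one
    rw [(hder 0).deriv, (hder 1).deriv] at this
    simp only [zero_smul, add_zero, one_smul, add_sub_cancel] at this
    rw [← real_inner_self_eq_norm_sq, inner_sub_left (∇ F x), inner_sub_left x y (x - y)]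
    linarith
  · intro h
    refine ⟨convex_univ, fun x _ y _ a b ha hb hab => ?_⟩
    have hx := quadratic_lower_bound_of_gradient hF h (a • x + b • y) x
    have hy := quadratic_lower_bound_of_gradient hF h (a • x + b • y) y
    obtain rfl : a = 1 - b := by linarith
    have e1 : x - ((1 - b) • x + b • y) = b • (x - y) := by module
    have e2 : y - ((1 - b) • x + b • y) = (-(1 - b)) • (x - y) := by module
    rw [e1, inner_smul_right, norm_smul, mul_pow, Real.norm_eq_abs, sq_abs] at hx
    rw [e2, inner_smul_right, norm_smul, mul_pow, Real.norm_eq_abs, sq_abs] at hy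
    simp only [smul_eq_mul]
    have h1 := mul_le_mul_of_nonneg_left hx ha
    have h2 := mul_le_mul_of_nonneg_left hy hb
    linarith

/-- A convex function whose gradient satisfies the one-sided bound `l` is co-coercive. -/
theorem gradient_cocoercive {F : E → ℝ} (hF : Differentiable ℝ F) {l : ℝ} (hl : 0 < l)
    (hconv : ∀ x y, 0 ≤ ⟪∇ F x - ∇ F y, x - y⟫_ℝ)
    (hsm : ∀ x y, ⟪∇ F x - ∇ F y, x - y⟫_ℝ ≤ l * ‖x - y‖ ^ 2) (x y : E) :
    ‖∇ F x - ∇ F y‖ ^ 2 ≤ l * ⟪∇ F x - ∇ F y, x - y⟫_ℝ := by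
  have key : ∀ x y, F x + ⟪∇ F x, y - x⟫_ℝ + ‖∇ F y - ∇ F x‖ ^ 2 / (2 * l) ≤ F y := by
    intro x y
    set w := ∇ F y - ∇ F x with hw
    -- The point `y - l⁻¹ w` minimizes the quadratic upper model at `y` of `F - ⟪∇ F x, ·⟫`, a
    -- convex function that is minimal at `x`.
    have h1 := quadratic_lower_bound_of_gradient hF (m := 0) (by simpa using hconv) x
      (y - l⁻¹ • w)
    have h2 := quadratic_upper_bound_of_gradient hF hsm y (y - l⁻¹ • w)
    have e1 : y - l⁻¹ • w - x = (y - x) - l⁻¹ • w := by abel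
    have e2 : y - l⁻¹ • w - y = -(l⁻¹ • w) := by abel
    have e3 : ⟪∇ F y, w⟫_ℝ = ⟪∇ F x, w⟫_ℝ + ‖w‖ ^ 2 := by
      rw [← real_inner_self_eq_norm_sq, ← inner_add_left, hw, add_sub_cancel]
    rw [e1, inner_sub_right, inner_smul_right] at h1
    rw [e2, inner_neg_right, inner_smul_right, norm_neg, norm_smul, mul_pow, Real.norm_eq_abs,
      sq_abs, e3] at h2
    have e4 : l / 2 * (l⁻¹ ^ 2 * ‖w‖ ^ 2) = ‖w‖ ^ 2 / (2 * l) := by field_simp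
    have e5 : l⁻¹ * ‖w‖ ^ 2 = 2 * (‖w‖ ^ 2 / (2 * l)) := by field_simp
    rw [e4, mul_add, e5] at h2
    linarith
  have h1 := key x y
  have h2 := key y x
  rw [norm_sub_rev, ← neg_sub x y, inner_neg_right] at h1
  rw [inner_sub_left]
  have h3 : ‖∇ F x - ∇ F y‖ ^ 2 / l ≤ ⟪∇ F x, x - y⟫_ℝ - ⟪∇ F y, x - y⟫_ℝ := by
    have : ‖∇ F x - ∇ F y‖ ^ 2 / l = 2 * (‖∇ F x - ∇ F y‖ ^ 2 / (2 * l)) := by field_simp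
    linarith
  rw [div_le_iff₀ hl] at h3
  linarith

theorem gradient_lipschitz {F : E → ℝ} (hF : Differentiable ℝ F) {l : ℝ} (hl : 0 < l)
    (hconv : ∀ x y, 0 ≤ ⟪∇ F x - ∇ F y, x - y⟫_ℝ)
    (hsm : ∀ x y, ⟪∇ F x - ∇ F y, x - y⟫_ℝ ≤ l * ‖x - y‖ ^ 2) (x y : E) :
    ‖∇ F x - ∇ F y‖ ≤ l * ‖x - y‖ := by
  have h1 := gradient_cocoercive hF hl hconv hsm x y
  have h2 := mul_le_mul_of_nonneg_left (hsm x y) hl.le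
  refine le_of_sq_le_sq ?_ (by positivity)
  rw [mul_pow]
  linarith

end GradientInequalities

/-! ### Coercivity and Lyapunov decay in an abstract Hilbert space -/

section Flow

/-- Grönwall's argument: `W t * exp (r t)` is nonincreasing. -/
theorem le_exp_of_hasDerivWithinAt_le {W W' : ℝ → ℝ} {r : ℝ}
    (hW : ∀ t, 0 ≤ t → HasDerivWithinAt W (W' t) (Set.Ici 0) t)
    (hle : ∀ t, 0 ≤ t → W' t ≤ -r * W t) {t : ℝ} (ht : 0 ≤ t) :
    W t ≤ W 0 * Real.exp (-r * t) := by
  have hder : ∀ t, 0 ≤ t → HasDerivWithinAt (fun t => W t * Real.exp (r * t))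
      (W' t * Real.exp (r * t) + W t * (Real.exp (r * t) * r)) (Set.Ici 0) t := by
    intro t ht
    have h1 : HasDerivAt (fun t : ℝ => Real.exp (r * t)) (Real.exp (r * t) * r) t := by
      simpa using ((hasDerivAt_id t).const_mul r).exp
    exact (hW t ht).mul h1.hasDerivWithinAt
  have hanti : AntitoneOn (fun t => W t * Real.exp (r * t)) (Set.Ici 0) := by
    refine antitoneOn_of_hasDerivWithinAt_nonpos (convex_Ici 0)
      (fun t ht => (hder t ht).continuousWithinAt)
      (fun t ht => (hder t (interior_subset ht)).mono interior_subset) fun t ht => ?_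
    have h1 := hle t (interior_subset ht)
    have h2 := Real.exp_pos (r * t)
    nlinarith
  have h := hanti (Set.mem_Ici.2 le_rfl) (Set.mem_Ici.2 ht) ht
  simp only [mul_zero, Real.exp_zero, mul_one] at h
  have h2 : Real.exp (r * t) * Real.exp (-r * t) = 1 := by
    rw [← Real.exp_add]
    simp
  calc W t = W t * Real.exp (r * t) * Real.exp (-r * t) := by rw [mul_assoc, h2, mul_one]
    _ ≤ W 0 * Real.exp (-r * t) := mul_le_mul_of_nonneg_right h (Real.exp_pos _).le

variable {E : Type*} [NormedAddCommGroup E] [InnerProductSpace ℝ E]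

/-- A positive semidefinite map is uniformly positive definite on the orthogonal complement of its
kernel. -/
theorem exists_coercive_orthogonal_ker [FiniteDimensional ℝ E] (A : E →L[ℝ] E)
    (hpos : ∀ x, 0 ≤ ⟪A x, x⟫_ℝ) (hker : ∀ x, ⟪A x, x⟫_ℝ = 0 → A x = 0) :
    ∃ σ : ℝ, 0 < σ ∧ ∀ v ∈ A.kerᗮ, σ * ‖v‖ ^ 2 ≤ ⟪A v, v⟫_ℝ := by
  have hcomp : IsCompact ((A.kerᗮ : Set E) ∩ Metric.sphere 0 1) :=
    (isCompact_sphere (0 : E) 1).inter_left (Submodule.closed_of_finiteDimensional _)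
  rcases ((A.kerᗮ : Set E) ∩ Metric.sphere 0 1).eq_empty_or_nonempty with hne | hne
  -- Here the orthogonal complement is trivial, so any positive constant serves.
  · refine ⟨1, one_pos, fun v hv => ?_⟩
    by_cases h0 : v = 0
    · simp [h0]
    · refine (Set.eq_empty_iff_forall_notMem.1 hne (‖v‖⁻¹ • v)
        ⟨A.kerᗮ.smul_mem ‖v‖⁻¹ hv, ?_⟩).elim
      rw [mem_sphere_zero_iff_norm, norm_smul, norm_inv, norm_norm,
        inv_mul_cancel₀ (norm_ne_zero_iff.2 h0)]
  · obtain ⟨u, ⟨hu1, hu2⟩, hmin⟩ := hcomp.exists_isMinOn hne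
      (f := fun v => ⟪A v, v⟫_ℝ) (by fun_prop)
    refine ⟨⟪A u, u⟫_ℝ, lt_of_le_of_ne (hpos u) fun h => ?_, fun v hv => ?_⟩
    · have hu : u ∈ A.ker := hker u h.symm
      have : ⟪u, u⟫_ℝ = 0 := (Submodule.mem_orthogonal _ _).1 hu1 u hu
      rw [real_inner_self_eq_norm_sq, mem_sphere_zero_iff_norm.1 hu2] at this
      norm_num at this
    · by_cases h0 : v = 0
      · simp [h0]
      have hn := norm_ne_zero_iff.2 h0
      have h1 : ‖v‖⁻¹ • v ∈ (A.kerᗮ : Set E) ∩ Metric.sphere 0 1 :=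
        ⟨A.kerᗮ.smul_mem _ hv, by
          rw [mem_sphere_zero_iff_norm, norm_smul, norm_inv, norm_norm, inv_mul_cancel₀ hn]⟩
      have h2 := hmin h1
      simp only [Set.mem_ofPred_eq, map_smul, inner_smul_left, inner_smul_right,
        RCLike.conj_to_real] at h2
      calc ⟪A u, u⟫_ℝ * ‖v‖ ^ 2 ≤ (‖v‖⁻¹ * (‖v‖⁻¹ * ⟪A v, v⟫_ℝ)) * ‖v‖ ^ 2 :=
            mul_le_mul_of_nonneg_right h2 (sq_nonneg _)
        _ = ⟪A v, v⟫_ℝ := by field_simp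

/-- Supplies the multiplier: a gradient orthogonal to the kernel lies in the range. -/
theorem exists_apply_eq_of_mem_orthogonal_ker [FiniteDimensional ℝ E] (A : E →L[ℝ] E)
    (hsymm : ∀ x y, ⟪A x, y⟫_ℝ = ⟪x, A y⟫_ℝ) {v : E} (hv : v ∈ A.kerᗮ) : ∃ w, A w = v := by
  have h := LinearMap.IsSymmetric.orthogonal_range (T := (A : E →ₗ[ℝ] E)) hsymm
  have h2 : A.kerᗮ = (A : E →ₗ[ℝ] E).range := by
    rw [← h, Submodule.orthogonal_orthogonal]
  rw [h2] at hv
  exact hv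

theorem map_mem_orthogonal_ker (A : E →L[ℝ] E)
    (hsymm : ∀ x y, ⟪A x, y⟫_ℝ = ⟪x, A y⟫_ℝ) (w : E) : A w ∈ A.kerᗮ := by
  rw [Submodule.mem_orthogonal]
  intro k hk
  rw [← hsymm, show A k = 0 from hk, inner_zero_left]

/-- Monotonicity, strong monotonicity on `ker A` and a proportional term `α A` add up to
strong monotonicity around a point of `ker A`. -/
theorem exists_proportional_coercive [CompleteSpace E] {F : E → ℝ} {l : ℝ} (hl : 0 < l)
    (hconv : ∀ x y, 0 ≤ ⟪∇ F x - ∇ F y, x - y⟫_ℝ)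
    (hlip : ∀ x y, ‖∇ F x - ∇ F y‖ ≤ l * ‖x - y‖)
    (A : E →L[ℝ] E) [A.ker.HasOrthogonalProjection] (hsymm : ∀ x y, ⟪A x, y⟫_ℝ = ⟪x, A y⟫_ℝ)
    {σ : ℝ} (hσ : 0 < σ) (hcoer : ∀ v ∈ A.kerᗮ, σ * ‖v‖ ^ 2 ≤ ⟪A v, v⟫_ℝ)
    {m : ℝ} (hm : 0 < m)
    (hstrong : ∀ x y, A x = 0 → A y = 0 → m * ‖x - y‖ ^ 2 ≤ ⟪∇ F x - ∇ F y, x - y⟫_ℝ)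
    {α : ℝ} (hα : 0 < α) {z : E} (hz : A z = 0) :
    ∃ κ : ℝ, 0 < κ ∧ ∀ x,
      κ * ‖x - z‖ ^ 2 ≤ ⟪∇ F x - ∇ F z, x - z⟫_ℝ + α * ⟪A (x - z), x - z⟫_ℝ := by
  -- Only the fraction `θ` of the monotonicity term is used, so that its negative `‖q‖²` part costs
  -- at most half of the proportional term; `θ ≤ 1` gives `θ S ≤ S` as `S ≥ 0`.
  set θ : ℝ := min 1 (α * σ * m / (4 * l ^ 2)) with hθ
  have hθ0 : 0 < θ := by positivity
  refine ⟨min (θ * m / 2) (α * σ / 2), by positivity, fun x => ?_⟩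
  set p := A.ker.starProjection (x - z) with hp
  have hpK : A p = 0 := A.ker.starProjection_apply_mem (x - z)
  set q := x - z - p with hq
  have hqK : q ∈ A.kerᗮ := A.ker.sub_starProjection_mem_orthogonal (x - z)
  have hxz : x - z = p + q := by rw [hq]; abel
  have hpq : ⟪p, q⟫_ℝ = 0 := (Submodule.mem_orthogonal _ _).1 hqK p hpK
  have hnorm : ‖x - z‖ ^ 2 = ‖p‖ ^ 2 + ‖q‖ ^ 2 := by
    rw [hxz, norm_add_sq_real, hpq]; ring
  have hA : ⟪A (x - z), x - z⟫_ℝ = ⟪A q, q⟫_ℝ := by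
    rw [hxz, map_add, hpK, zero_add, inner_add_right, hsymm q p, hpK, inner_zero_right, zero_add]
  have hAq := hcoer q hqK
  have h1 := hstrong (z + p) z (by rw [map_add, hz, hpK, add_zero]) hz
  have h2 := hconv x (z + p)
  have h3 := hlip x (z + p)
  have h4 := hlip (z + p) z
  have e1 : x - (z + p) = q := by rw [hq]; abel
  rw [e1] at h2 h3
  rw [add_sub_cancel_left] at h1 h4
  have h5 : -(l * ‖q‖ * ‖p‖) ≤ ⟪∇ F x - ∇ F (z + p), p⟫_ℝ := by
    have := abs_le.1 (abs_real_inner_le_norm (∇ F x - ∇ F (z + p)) p)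
    nlinarith [mul_le_mul_of_nonneg_right h3 (norm_nonneg p)]
  have h6 : -(l * ‖p‖ * ‖q‖) ≤ ⟪∇ F (z + p) - ∇ F z, q⟫_ℝ := by
    have := abs_le.1 (abs_real_inner_le_norm (∇ F (z + p) - ∇ F z) q)
    nlinarith [mul_le_mul_of_nonneg_right h4 (norm_nonneg q)]
  -- Passing through the kernel point `z + p` isolates a strongly monotone term in `p`, a
  -- nonnegative term in `q`, and two mixed terms, each at least `-l ‖p‖ ‖q‖`.
  have hS : ⟪∇ F x - ∇ F z, x - z⟫_ℝ = ⟪∇ F x - ∇ F (z + p), p⟫_ℝ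
      + ⟪∇ F x - ∇ F (z + p), q⟫_ℝ + ⟪∇ F (z + p) - ∇ F z, p⟫_ℝ
      + ⟪∇ F (z + p) - ∇ F z, q⟫_ℝ := by
    rw [hxz, inner_add_right]
    simp only [inner_sub_left]
    ring
  have hS0 := hconv x z
  set S := ⟪∇ F x - ∇ F z, x - z⟫_ℝ
  have hS1 : m / 2 * ‖p‖ ^ 2 - 2 * l ^ 2 / m * ‖q‖ ^ 2 ≤ S := by
    have h7 : 0 ≤ m / 2 * (‖p‖ - 2 * l / m * ‖q‖) ^ 2 := by positivity
    have h8 : m / 2 * (‖p‖ - 2 * l / m * ‖q‖) ^ 2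
        = m / 2 * ‖p‖ ^ 2 - 2 * l * ‖p‖ * ‖q‖ + 2 * l ^ 2 / m * ‖q‖ ^ 2 := by
      field_simp
      ring
    linarith
  have hθ1 : θ * S ≤ S := by
    nlinarith [min_le_left 1 (α * σ * m / (4 * l ^ 2))]
  have hθ2 : θ * (2 * l ^ 2 / m) ≤ α * σ / 2 := by
    calc θ * (2 * l ^ 2 / m) ≤ α * σ * m / (4 * l ^ 2) * (2 * l ^ 2 / m) :=
          mul_le_mul_of_nonneg_right (min_le_right _ _) (by positivity)
      _ = α * σ / 2 := by field_simp; norm_num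
  have h9 := mul_le_mul_of_nonneg_left hS1 hθ0.le
  have h10 := mul_le_mul_of_nonneg_right hθ2 (sq_nonneg ‖q‖)
  have h11 := mul_le_mul_of_nonneg_right (min_le_left (θ * m / 2) (α * σ / 2)) (sq_nonneg ‖p‖)
  have h12 := mul_le_mul_of_nonneg_right (min_le_right (θ * m / 2) (α * σ / 2)) (sq_nonneg ‖q‖)
  have h13 := mul_le_mul_of_nonneg_left hAq hα.le
  rw [hA, hnorm]
  linarith

/-- Exponential convergence of the primal variable of the proportional-integral primal-dual flow,
uniformly over all solutions and all multipliers. -/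
theorem exists_exponential_bound_flow [FiniteDimensional ℝ E] {F : E → ℝ} {l : ℝ} (hl : 0 < l)
    (hconv : ∀ x y, 0 ≤ ⟪∇ F x - ∇ F y, x - y⟫_ℝ)
    (hlip : ∀ x y, ‖∇ F x - ∇ F y‖ ≤ l * ‖x - y‖)
    (A : E →L[ℝ] E) (hsymm : ∀ x y, ⟪A x, y⟫_ℝ = ⟪x, A y⟫_ℝ)
    (hpos : ∀ x, 0 ≤ ⟪A x, x⟫_ℝ) (hker : ∀ x, ⟪A x, x⟫_ℝ = 0 → A x = 0)
    {m : ℝ} (hm : 0 < m)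
    (hstrong : ∀ x y, A x = 0 → A y = 0 → m * ‖x - y‖ ^ 2 ≤ ⟪∇ F x - ∇ F y, x - y⟫_ℝ)
    {α : ℝ} (hα : 0 < α) {z : E} (hz : A z = 0) :
    ∃ c ρ : ℝ, 0 ≤ c ∧ 0 < ρ ∧ ∀ x lam : ℝ → E,
      (∀ t : ℝ, 0 ≤ t →
        HasDerivWithinAt x (-∇ F (x t) - α • A (x t) - A (lam t)) (Set.Ici 0) t ∧
        HasDerivWithinAt lam (A (x t)) (Set.Ici 0) t) →
      ∀ ν : E, ∇ F z + A ν = 0 → ∀ t : ℝ, 0 ≤ t →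
        ‖x t - z‖ ≤ c * Real.exp (-ρ * t) *
          Real.sqrt (‖x 0 - z‖ ^ 2 + ‖lam 0 - ν‖ ^ 2) := by
  obtain ⟨σ, hσ, hcoer⟩ := exists_coercive_orthogonal_ker A hpos hker
  obtain ⟨κ, hκ, hκb⟩ := exists_proportional_coercive hl hconv hlip A hsymm hσ hcoer hm hstrong hα hz
  set B := ‖A‖
  set C := l + α * B with hC
  set D := C ^ 2 / (2 * σ) + B with hD
  have hB : 0 ≤ B := norm_nonneg A
  have hC0 : 0 ≤ C := by positivity
  have hD0 : 0 ≤ D := by positivity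
  -- The bound `1 / 2` keeps `W` comparable to the squared errors; the other makes the cross term
  -- consume at most half of `κ`. The `+ 1` covers `D = 0`.
  set ε := min (1 / 2) (κ / (2 * (D + 1))) with hε
  have hε0 : 0 < ε := by positivity
  have hεh : ε ≤ 1 / 2 := min_le_left _ _
  have hεD : ε * D ≤ κ / 2 := by
    have h1 : ε ≤ κ / (2 * (D + 1)) := min_le_right _ _
    rw [le_div_iff₀ (by positivity)] at h1
    nlinarith
  set r := min (κ / 2) (ε * σ / 2) with hr
  have hr0 : 0 < r := by positivity
  refine ⟨2, r / 2, by norm_num, by positivity, fun x lam hflow ν hν t ht => ?_⟩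
  -- Only the component of the dual error orthogonal to the kernel enters the flow, and only there
  -- is `A` coercive.
  set P := A.kerᗮ.starProjection with hP
  set e : ℝ → E := fun t => x t - z with he
  set η : ℝ → E := fun t => P (lam t - ν) with hη
  have hηK : ∀ t, η t ∈ A.kerᗮ := fun t => A.kerᗮ.starProjection_apply_mem _
  have hAη : ∀ t, A (η t) = A (lam t) - A ν := by
    intro t
    have h1 := A.kerᗮ.sub_starProjection_mem_orthogonal (lam t - ν)
    rw [Submodule.orthogonal_orthogonal] at h1
    have h2 : A (lam t - ν - η t) = 0 := h1
    rw [map_sub, map_sub, sub_eq_zero] at h2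
    exact h2.symm
  have hPA : ∀ w, P (A w) = A w := fun w =>
    Submodule.starProjection_eq_self_iff.2 (map_mem_orthogonal_ker A hsymm w)
  set h : ℝ → E := fun t => ∇ F (x t) - ∇ F z with hh
  have he' : ∀ t, 0 ≤ t →
      HasDerivWithinAt e (-h t - α • A (e t) - A (η t)) (Set.Ici 0) t := by
    intro t ht
    refine ((hflow t ht).1.sub_const z).congr_deriv ?_
    rw [hAη, hh, he]
    simp only [map_sub, hz, sub_zero]
    rw [eq_neg_of_add_eq_zero_left hν]
    abel
  have hη' : ∀ t, 0 ≤ t → HasDerivWithinAt η (A (e t)) (Set.Ici 0) t := by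
    intro t ht
    refine (P.hasFDerivAt.comp_hasDerivWithinAt t ((hflow t ht).2.sub_const ν)).congr_deriv ?_
    rw [hPA, he, map_sub, hz, sub_zero]
  -- In the derivative of the squared norms the couplings of `e` and `η` cancel, leaving no decay in
  -- `η`; the cross term contributes `-ε ⟪A η, η⟫`.
  set W : ℝ → ℝ := fun t => (‖e t‖ ^ 2 + ‖η t‖ ^ 2) / 2 + ε * ⟪e t, η t⟫_ℝ with hW
  have hinner : ∀ t, |⟪e t, η t⟫_ℝ| ≤ (‖e t‖ ^ 2 + ‖η t‖ ^ 2) / 2 := fun t =>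
    (abs_real_inner_le_norm _ _).trans (by nlinarith [sq_nonneg (‖e t‖ - ‖η t‖)])
  have hWlow : ∀ t, ‖e t‖ ^ 2 ≤ 4 * W t := by
    intro t
    have h1 := abs_le.1 (hinner t)
    simp only [hW]
    nlinarith [sq_nonneg ‖η t‖, sq_nonneg ‖e t‖]
  have hWup : ∀ t, W t ≤ ‖e t‖ ^ 2 + ‖η t‖ ^ 2 := by
    intro t
    have h1 := abs_le.1 (hinner t)
    simp only [hW]
    nlinarith [sq_nonneg ‖η t‖, sq_nonneg ‖e t‖]
  have hWder : ∀ t, 0 ≤ t → HasDerivWithinAt W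
      ((2 * ⟪e t, -h t - α • A (e t) - A (η t)⟫_ℝ + 2 * ⟪η t, A (e t)⟫_ℝ) / 2
        + ε * (⟪e t, A (e t)⟫_ℝ + ⟪-h t - α • A (e t) - A (η t), η t⟫_ℝ)) (Set.Ici 0) t :=
    fun t ht => (((he' t ht).norm_sq.add (hη' t ht).norm_sq).div_const 2).add
      (((he' t ht).inner ℝ (hη' t ht)).const_mul ε)
  have hWle : ∀ t, 0 ≤ t →
      (2 * ⟪e t, -h t - α • A (e t) - A (η t)⟫_ℝ + 2 * ⟪η t, A (e t)⟫_ℝ) / 2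
        + ε * (⟪e t, A (e t)⟫_ℝ + ⟪-h t - α • A (e t) - A (η t), η t⟫_ℝ) ≤ -r * W t := by
    intro t _
    have h1 : κ * ‖e t‖ ^ 2 ≤ ⟪h t, e t⟫_ℝ + α * ⟪A (e t), e t⟫_ℝ := hκb (x t)
    have h2 := hcoer _ (hηK t)
    have h3 : ⟪e t, A (η t)⟫_ℝ = ⟪η t, A (e t)⟫_ℝ := by rw [← hsymm, real_inner_comm]
    have h4 : ‖A (e t)‖ ≤ B * ‖e t‖ := A.le_opNorm _
    have h5 : ‖h t‖ ≤ l * ‖e t‖ := hlip _ _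
    have h6 : ⟪e t, A (e t)⟫_ℝ ≤ B * ‖e t‖ ^ 2 :=
      (real_inner_le_norm _ _).trans (by nlinarith [norm_nonneg (e t)])
    have h7 : -(⟪h t, η t⟫_ℝ + α * ⟪A (e t), η t⟫_ℝ) ≤ C * ‖e t‖ * ‖η t‖ := by
      have i1 := (abs_le.1 (abs_real_inner_le_norm (h t) (η t))).1
      have i2 := (abs_le.1 (abs_real_inner_le_norm (A (e t)) (η t))).1
      have i3 := mul_le_mul_of_nonneg_right h5 (norm_nonneg (η t))
      have i4 := mul_le_mul_of_nonneg_right h4 (norm_nonneg (η t))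
      have i5 := mul_le_mul_of_nonneg_left (i4.trans' (neg_le.1 i2)) hα.le
      rw [hC]
      linarith
    have h8 : C * ‖e t‖ * ‖η t‖ ≤ σ / 2 * ‖η t‖ ^ 2 + C ^ 2 / (2 * σ) * ‖e t‖ ^ 2 := by
      have i1 : 0 ≤ σ / 2 * (‖η t‖ - C / σ * ‖e t‖) ^ 2 := by positivity
      have i2 : σ / 2 * (‖η t‖ - C / σ * ‖e t‖) ^ 2 = σ / 2 * ‖η t‖ ^ 2
          + C ^ 2 / (2 * σ) * ‖e t‖ ^ 2 - C * ‖e t‖ * ‖η t‖ := by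
        field_simp
        ring
      linarith
    have h9 : ⟪e t, A (e t)⟫_ℝ + ⟪-h t - α • A (e t) - A (η t), η t⟫_ℝ
        ≤ D * ‖e t‖ ^ 2 - σ / 2 * ‖η t‖ ^ 2 := by
      rw [inner_sub_left (-h t - α • A (e t)), inner_sub_left (-h t), inner_neg_left,
        inner_smul_left, RCLike.conj_to_real, hD]
      linarith
    have h10 : (2 * ⟪e t, -h t - α • A (e t) - A (η t)⟫_ℝ + 2 * ⟪η t, A (e t)⟫_ℝ) / 2
        ≤ -(κ * ‖e t‖ ^ 2) := by
      rw [inner_sub_right, inner_sub_right, inner_neg_right, inner_smul_right, h3,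
        real_inner_comm (h t), real_inner_comm (A (e t)) (e t)]
      linarith
    have h11 := mul_le_mul_of_nonneg_left h9 hε0.le
    have h12 := mul_le_mul_of_nonneg_right hεD (sq_nonneg ‖e t‖)
    have h13 := mul_le_mul_of_nonneg_right (min_le_left (κ / 2) (ε * σ / 2)) (sq_nonneg ‖e t‖)
    have h14 := mul_le_mul_of_nonneg_right (min_le_right (κ / 2) (ε * σ / 2)) (sq_nonneg ‖η t‖)
    have h15 := mul_le_mul_of_nonneg_left (hWup t) hr0.le
    linarith
  have hfin := le_exp_of_hasDerivWithinAt_le hWder hWle ht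
  have hη0 : ‖η 0‖ ≤ ‖lam 0 - ν‖ := A.kerᗮ.norm_starProjection_apply_le _
  have hW0 : W 0 ≤ ‖x 0 - z‖ ^ 2 + ‖lam 0 - ν‖ ^ 2 :=
    (hWup 0).trans (add_le_add le_rfl (pow_le_pow_left₀ (norm_nonneg _) hη0 2))
  refine le_of_sq_le_sq ?_ (by positivity)
  rw [mul_pow, mul_pow, Real.sq_sqrt (by positivity), ← Real.exp_nat_mul]
  have hexp : ((2 : ℕ) : ℝ) * (-(r / 2) * t) = -r * t := by
    push_cast
    ring
  rw [hexp]
  have h1 := mul_le_mul_of_nonneg_right hW0 (Real.exp_pos (-r * t)).le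
  have h2 := hWlow t
  change ‖e t‖ ^ 2 ≤ _
  linarith

end Flow

/-! ### The graph Laplacian and its quadratic form -/

theorem CommGraph.sum_laplacian_mul {N : ℕ} (G : CommGraph N) (v : Fin N → ℝ) (i : Fin N) :
    ∑ j, G.laplacian i j * v j = ∑ j, G.weight i j * (v i - v j) := by
  simp only [laplacian, Matrix.sub_apply, Matrix.of_apply, Matrix.diagonal_apply, sub_mul, mul_sub,
    Finset.sum_sub_distrib, ite_mul, zero_mul, Finset.sum_ite_eq, Finset.mem_univ, if_true,
    Finset.sum_mul]

/-- Average the double sum with its copy under exchange of `i` and `j`, using symmetry of the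
weights. -/
theorem CommGraph.sum_laplacian_mul_mul {N : ℕ} (G : CommGraph N) (v : Fin N → ℝ) :
    ∑ i, (∑ j, G.laplacian i j * v j) * v i
      = (∑ i, ∑ j, G.weight i j * (v i - v j) ^ 2) / 2 := by
  have h1 : ∑ i, (∑ j, G.laplacian i j * v j) * v i
      = ∑ i, ∑ j, G.weight i j * (v i - v j) * v i := by
    simp only [G.sum_laplacian_mul, Finset.sum_mul]
  have h2 : ∑ i, ∑ j, G.weight i j * (v i - v j) * v i
      = ∑ i, ∑ j, G.weight i j * (v j - v i) * v j := by
    rw [Finset.sum_comm]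
    simp only [fun i j => G.symm j i]
  rw [h1, eq_div_iff two_ne_zero, mul_two]
  nth_rewrite 2 [h2]
  simp only [← Finset.sum_add_distrib]
  refine Finset.sum_congr rfl fun i _ => Finset.sum_congr rfl fun j _ => ?_
  ring

theorem CommGraph.laplacian_transpose {N : ℕ} (G : CommGraph N) :
    G.laplacianᵀ = G.laplacian := by
  ext i j
  simp only [laplacian, Matrix.transpose_apply, Matrix.sub_apply, Matrix.of_apply, G.symm j i]
  by_cases h : i = j
  · rw [h]
  · rw [Matrix.diagonal_apply_ne _ h, Matrix.diagonal_apply_ne _ (Ne.symm h)]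

/-! ### Stacked vectors, consensus and partial strong convexity -/

section Stack

variable {N n : ℕ}

theorem kronId_apply (M : Matrix (Fin N) (Fin N) ℝ) (x : Stack N n) (i : Fin N) (a : Fin n) :
    kronId M x (i, a) = ∑ j, M i j * x (j, a) := by
  simp [kronId, Matrix.mulVec, dotProduct, Fintype.sum_prod_type, Matrix.one_apply]

theorem kronId_mul (M M' : Matrix (Fin N) (Fin N) ℝ) (x : Stack N n) :
    kronId (M * M') x = kronId M (kronId M' x) := by
  ext ⟨i, a⟩
  simp only [kronId_apply, Matrix.mul_apply, Finset.sum_mul, Finset.mul_sum, mul_assoc]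
  exact Finset.sum_comm

theorem kronId_one (x : Stack N n) : kronId 1 x = x := by
  ext ⟨i, a⟩
  simp [kronId_apply, Matrix.one_apply]

/-- `M ⊗ I_n` as a continuous linear map. -/
noncomputable def kronIdCLM (M : Matrix (Fin N) (Fin N) ℝ) : Stack N n →L[ℝ] Stack N n :=
  LinearMap.toContinuousLinearMap
    { toFun := kronId M
      map_add' := fun x y => by
        ext ⟨i, a⟩
        simp [kronId_apply, mul_add, Finset.sum_add_distrib]
      map_smul' := fun c x => by
        ext ⟨i, a⟩
        simp [kronId_apply, Finset.mul_sum, mul_left_comm] }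

theorem kronIdCLM_apply (M : Matrix (Fin N) (Fin N) ℝ) (x : Stack N n) :
    kronIdCLM M x = kronId M x := rfl

theorem kronId_sub (M : Matrix (Fin N) (Fin N) ℝ) (x y : Stack N n) :
    kronId M (x - y) = kronId M x - kronId M y :=
  map_sub (kronIdCLM M) x y

theorem inner_kronId (M : Matrix (Fin N) (Fin N) ℝ) (x y : Stack N n) :
    ⟪kronId M x, y⟫_ℝ = ⟪x, kronId Mᵀ y⟫_ℝ := by
  simp only [PiLp.inner_apply, Fintype.sum_prod_type_right, kronId_apply, Matrix.transpose_apply,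
    RCLike.inner_apply, RCLike.conj_to_real, Finset.mul_sum, Finset.sum_mul]
  refine Finset.sum_congr rfl fun a _ => ?_
  rw [Finset.sum_comm]
  refine Finset.sum_congr rfl fun i _ => Finset.sum_congr rfl fun j _ => ?_
  ring

theorem inner_kronId_laplacian_self (G : CommGraph N) (x : Stack N n) :
    ⟪kronId G.laplacian x, x⟫_ℝ
      = ∑ a, (∑ i, ∑ j, G.weight i j * (x (i, a) - x (j, a)) ^ 2) / 2 := by
  simp only [PiLp.inner_apply, Fintype.sum_prod_type_right, kronId_apply, RCLike.inner_apply,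
    RCLike.conj_to_real]
  refine Finset.sum_congr rfl fun a _ => ?_
  rw [← G.sum_laplacian_mul_mul fun i => x (i, a)]
  exact Finset.sum_congr rfl fun i _ => mul_comm _ _

theorem inner_kronId_laplacian_self_nonneg (G : CommGraph N) (x : Stack N n) :
    0 ≤ ⟪kronId G.laplacian x, x⟫_ℝ := by
  rw [inner_kronId_laplacian_self]
  exact Finset.sum_nonneg fun a _ => div_nonneg (Finset.sum_nonneg fun i _ =>
    Finset.sum_nonneg fun j _ => mul_nonneg (G.nonneg i j) (sq_nonneg _)) zero_le_two

/-- The linear embedding `u ↦ 1_N ⊗ u`. -/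
noncomputable def consensus (N n : ℕ) : EuclideanSpace ℝ (Fin n) →L[ℝ] Stack N n :=
  LinearMap.toContinuousLinearMap
    { toFun := fun u => WithLp.toLp 2 fun p => u p.2
      map_add' := fun _ _ => rfl
      map_smul' := fun _ _ => rfl }

theorem consensus_apply (u : EuclideanSpace ℝ (Fin n)) (i : Fin N) (a : Fin n) :
    consensus N n u (i, a) = u a := rfl

theorem norm_sq_consensus (u : EuclideanSpace ℝ (Fin n)) :
    ‖consensus N n u‖ ^ 2 = N * ‖u‖ ^ 2 := by
  simp [EuclideanSpace.norm_sq_eq, Fintype.sum_prod_type, consensus_apply]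

theorem kronId_laplacian_consensus (G : CommGraph N) (u : EuclideanSpace ℝ (Fin n)) :
    kronId G.laplacian (consensus N n u) = 0 := by
  ext ⟨i, a⟩
  simp only [kronId_apply, consensus_apply]
  rw [G.sum_laplacian_mul (fun _ => u a)]
  simp

/-- A vanishing sum of nonnegative edge terms forces equality across each edge, hence along paths.
Assuming only a zero quadratic form also gives the kernel condition required by the flow estimate.
-/
theorem exists_eq_consensus {G : CommGraph N} (hG : G.toSimpleGraph.Connected) {x : Stack N n}
    (hx : ⟪kronId G.laplacian x, x⟫_ℝ = 0) : ∃ u, x = consensus N n u := by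
  rw [inner_kronId_laplacian_self] at hx
  have hterm : ∀ a i j, 0 ≤ G.weight i j * (x (i, a) - x (j, a)) ^ 2 := fun a i j =>
    mul_nonneg (G.nonneg i j) (sq_nonneg _)
  have h0 : ∀ a i j, G.weight i j * (x (i, a) - x (j, a)) ^ 2 = 0 := by
    intro a i j
    have h1 := (Finset.sum_eq_zero_iff_of_nonneg fun a _ => div_nonneg
      (Finset.sum_nonneg fun i _ => Finset.sum_nonneg fun j _ => hterm a i j)
      zero_le_two).1 hx a (Finset.mem_univ a)
    have h2 := (Finset.sum_eq_zero_iff_of_nonneg fun i _ =>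
      Finset.sum_nonneg fun j _ => hterm a i j).1 ((div_eq_zero_iff.1 h1).resolve_right two_ne_zero)
      i (Finset.mem_univ i)
    exact (Finset.sum_eq_zero_iff_of_nonneg fun j _ => hterm a i j).1 h2 j (Finset.mem_univ j)
  have hadj : ∀ a i j, G.toSimpleGraph.Adj i j → x (i, a) = x (j, a) := by
    intro a i j hij
    have hw : G.weight i j ≠ 0 := ne_of_gt hij
    exact sub_eq_zero.1 (pow_eq_zero_iff two_ne_zero |>.1
      ((mul_eq_zero.1 (h0 a i j)).resolve_left hw))
  have hreach : ∀ a i j, x (i, a) = x (j, a) := by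
    intro a i j
    obtain ⟨p⟩ := hG.preconnected i j
    induction p with
    | nil => rfl
    | cons h _ ih => exact (hadj a _ _ h).trans ih
  obtain ⟨i₀⟩ := hG.nonempty
  refine ⟨block x i₀, ?_⟩
  ext ⟨i, a⟩
  exact hreach a i i₀

theorem kronId_laplacian_eq_zero_iff {G : CommGraph N} (hG : G.toSimpleGraph.Connected)
    {x : Stack N n} : kronId G.laplacian x = 0 ↔ ∃ u, x = consensus N n u := by
  refine ⟨fun h => exists_eq_consensus hG (by rw [h, inner_zero_left]), ?_⟩
  rintro ⟨u, rfl⟩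
  exact kronId_laplacian_consensus G u

theorem differentiable_stackedCost {f : Fin N → EuclideanSpace ℝ (Fin n) → ℝ}
    (hf : ∀ i, Differentiable ℝ (f i)) : Differentiable ℝ (stackedCost f) := by
  have hblock : ∀ i, Differentiable ℝ fun x : Stack N n => block x i := fun i =>
    (LinearMap.toContinuousLinearMap
      { toFun := fun x : Stack N n => block x i
        map_add' := fun _ _ => rfl
        map_smul' := fun _ _ => rfl }).differentiable
  exact Differentiable.fun_sum fun i _ => (hf i).comp (hblock i)

/-- Inverting `Q` by its transpose, the block `s` pairs the constant column `1 / √N` with `N` copies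
of `u`, so it equals `√N u`. -/
theorem norm_block_eq_of_kronId_eq_consensus {Q : Matrix (Fin N) (Fin N) ℝ} {s : Fin N}
    (hQ : IsConsensusTransform Q s) {z : Stack N n} {u : EuclideanSpace ℝ (Fin n)}
    (hz : kronId Q z = consensus N n u) : ‖block z s‖ ^ 2 = ‖kronId Q z‖ ^ 2 := by
  have h1 : z = kronId Qᵀ (consensus N n u) := by
    have : Qᵀ * Q = 1 := Matrix.mem_orthogonalGroup_iff' _ _ |>.1 hQ.1
    rw [← hz, ← kronId_mul, this, kronId_one]
  have h2 : block z s = Real.sqrt N • u := by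
    ext a
    rw [h1]
    simp [block, kronId_apply, consensus_apply, hQ.2, ← mul_assoc, ← div_eq_mul_inv]
  rw [hz, norm_sq_consensus, h2, norm_smul, mul_pow, Real.norm_eq_abs, sq_abs,
    Real.sq_sqrt N.cast_nonneg]

/-- On the constraint subspace the block `x'_s` carries the whole norm, so partial strong convexity
is strong monotonicity of the gradient on the kernel of the Laplacian. -/
theorem consensusPartiallyStronglyConvex_iff {G : CommGraph N} (hG : G.toSimpleGraph.Connected)
    {f : Fin N → EuclideanSpace ℝ (Fin n) → ℝ} (hf : ∀ i, Differentiable ℝ (f i))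
    {Q : Matrix (Fin N) (Fin N) ℝ} {s : Fin N} (hQ : IsConsensusTransform Q s) (μ : ℝ) :
    ConsensusPartiallyStronglyConvex G Q s μ f ↔
      ∀ x y : Stack N n, kronId G.laplacian x = 0 → kronId G.laplacian y = 0 →
        μ * ‖x - y‖ ^ 2 ≤ ⟪∇ (stackedCost f) x - ∇ (stackedCost f) y, x - y⟫_ℝ := by
  have hgrad : ∀ x' y' : Stack N n,
      ⟪∇ (fun z : Stack N n => stackedCost f (kronId Q z)) x'
        - ∇ (fun z : Stack N n => stackedCost f (kronId Q z)) y', x' - y'⟫_ℝ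
      = ⟪∇ (stackedCost f) (kronId Q x') - ∇ (stackedCost f) (kronId Q y'),
          kronId Q x' - kronId Q y'⟫_ℝ := by
    intro x' y'
    have h := inner_gradient_comp_clm (differentiable_stackedCost hf) (kronIdCLM (n := n) Q)
    simp only [kronIdCLM_apply] at h
    rw [inner_sub_left, h, h, inner_sub_left, kronId_sub]
  have hnorm : ∀ x' y' : Stack N n, kronId G.laplacian (kronId Q x') = 0 →
      kronId G.laplacian (kronId Q y') = 0 →
      ‖block x' s - block y' s‖ ^ 2 = ‖kronId Q x' - kronId Q y'‖ ^ 2 := by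
    intro x' y' hx hy
    obtain ⟨u, hu⟩ := (kronId_laplacian_eq_zero_iff hG).1 hx
    obtain ⟨v, hv⟩ := (kronId_laplacian_eq_zero_iff hG).1 hy
    have h := norm_block_eq_of_kronId_eq_consensus hQ (z := x' - y') (u := u - v)
      (by rw [kronId_sub, hu, hv, map_sub])
    rwa [kronId_sub] at h
  have hinv : ∀ x : Stack N n, kronId Q (kronId Qᵀ x) = x := by
    intro x
    have : Q * Qᵀ = 1 := Matrix.mem_orthogonalGroup_iff _ _ |>.1 hQ.1
    rw [← kronId_mul, this, kronId_one]
  constructor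
  · intro h x y hx hy
    have := h (kronId Qᵀ x) (by rw [Set.mem_ofPred_eq, hinv]; exact hx)
      (kronId Qᵀ y) (by rw [Set.mem_ofPred_eq, hinv]; exact hy)
    rwa [hgrad, hnorm _ _ (by rwa [hinv]) (by rwa [hinv]), hinv, hinv] at this
  · intro h x' hx y' hy
    rw [hgrad, hnorm _ _ hx hy]
    exact h _ _ hx hy

theorem strongConvexOn_globalCost_iff {G : CommGraph N} (hG : G.toSimpleGraph.Connected)
    {f : Fin N → EuclideanSpace ℝ (Fin n) → ℝ} (hf : ∀ i, Differentiable ℝ (f i)) (μ : ℝ) :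
    StrongConvexOn Set.univ (N * μ) (globalCost f) ↔
      ∀ x y : Stack N n, kronId G.laplacian x = 0 → kronId G.laplacian y = 0 →
        μ * ‖x - y‖ ^ 2 ≤ ⟪∇ (stackedCost f) x - ∇ (stackedCost f) y, x - y⟫_ℝ := by
  have hF := differentiable_stackedCost hf
  rw [show globalCost f = stackedCost f ∘ consensus N n from rfl,
    strongConvexOn_univ_iff_gradient (hF.comp (consensus N n).differentiable)]
  have hiff : ∀ u v : EuclideanSpace ℝ (Fin n),
      N * μ * ‖u - v‖ ^ 2 ≤ ⟪∇ (stackedCost f ∘ consensus N n) u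
          - ∇ (stackedCost f ∘ consensus N n) v, u - v⟫_ℝ ↔
      μ * ‖consensus N n u - consensus N n v‖ ^ 2
        ≤ ⟪∇ (stackedCost f) (consensus N n u) - ∇ (stackedCost f) (consensus N n v),
            consensus N n u - consensus N n v⟫_ℝ := by
    intro u v
    have h := inner_gradient_comp_clm hF (consensus N n)
    rw [← map_sub, norm_sq_consensus, inner_sub_left, inner_sub_left, ← h, ← h, mul_left_comm,
      mul_assoc]
    rfl
  constructor
  · intro h x y hx hy
    obtain ⟨u, rfl⟩ := (kronId_laplacian_eq_zero_iff hG).1 hx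
    obtain ⟨v, rfl⟩ := (kronId_laplacian_eq_zero_iff hG).1 hy
    exact (hiff u v).1 (h u v)
  · intro h u v
    exact (hiff u v).2 (h _ _ (kronId_laplacian_consensus G u) (kronId_laplacian_consensus G v))

/-- First-order optimality: the gradient at an optimal solution is orthogonal to the constraint
subspace. -/
theorem IsOptimalSolution.inner_gradient_eq_zero {G : CommGraph N}
    {f : Fin N → EuclideanSpace ℝ (Fin n) → ℝ} (hf : ∀ i, Differentiable ℝ (f i)) {x : Stack N n}
    (hx : IsOptimalSolution G f x) {v : Stack N n} (hv : kronId G.laplacian v = 0) :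
    ⟪∇ (stackedCost f) x, v⟫_ℝ = 0 := by
  have hder := hasDerivAt_comp_line (differentiable_stackedCost hf) x v 0
  rw [zero_smul, add_zero] at hder
  -- The whole line through `x` in direction `v` is feasible, so `t = 0` is a two-sided minimum.
  refine IsLocalMin.hasDerivAt_eq_zero (Filter.Eventually.of_forall fun t => ?_) hder
  rw [zero_smul, add_zero]
  refine hx.2 _ ?_
  rw [← kronIdCLM_apply, map_add, map_smul, kronIdCLM_apply, kronIdCLM_apply, hx.1, hv, smul_zero,
    add_zero]

end Stack

/-! ### Equivalence, optimality and convergence -/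

theorem corollary1 {N n : ℕ} (G : CommGraph N) (hG : G.toSimpleGraph.Connected)
    (f : Fin N → EuclideanSpace ℝ (Fin n) → ℝ)
    (hdiff : ∀ i, Differentiable ℝ (f i))
    (hconv : GradMonotone (stackedCost f))
    (l : ℝ) (hl : 0 < l) (hsmooth : GradUpperBound l (stackedCost f))
    (hsol : ∃ x : Stack N n, IsOptimalSolution G f x)
    (Q : Matrix (Fin N) (Fin N) ℝ) (s : Fin N) (hQ : IsConsensusTransform Q s)
    (α : ℝ) (hα : 0 < α) :
    ((∃ μ : ℝ, 0 < μ ∧ ConsensusPartiallyStronglyConvex G Q s μ f) ↔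
      ∃ m : ℝ, 0 < m ∧ StrongConvexOn Set.univ m (globalCost f)) ∧
    ((∃ μ : ℝ, 0 < μ ∧ ConsensusPartiallyStronglyConvex G Q s μ f) →
      ∃ xs : Stack N n, IsOptimalSolution G f xs ∧
        (∀ y : Stack N n, IsOptimalSolution G f y → y = xs) ∧
        (∃ lams : Stack N n, IsEquilibrium G f xs lams) ∧
        ∃ c ρ : ℝ, 0 ≤ c ∧ 0 < ρ ∧
          ∀ x lam : ℝ → Stack N n, IsPIFlow G α f x lam →
            ∀ lams : Stack N n, IsEquilibrium G f xs lams →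
              ∀ t : ℝ, 0 ≤ t →
                ‖x t - xs‖ ≤ c * Real.exp (-ρ * t) *
                  Real.sqrt (‖x 0 - xs‖ ^ 2 + ‖lam 0 - lams‖ ^ 2)) := by
  have hF := differentiable_stackedCost hdiff
  have hiff : ∀ μ : ℝ, ConsensusPartiallyStronglyConvex G Q s μ f ↔
      StrongConvexOn Set.univ (N * μ) (globalCost f) := fun μ =>
    (consensusPartiallyStronglyConvex_iff hG hdiff hQ μ).trans
      (strongConvexOn_globalCost_iff hG hdiff μ).symm
  have hN : (0 : ℝ) < N := Nat.cast_pos.2 (Fin.pos s)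
  refine ⟨⟨fun ⟨μ, hμ, h⟩ => ⟨N * μ, mul_pos hN hμ, (hiff μ).1 h⟩,
    fun ⟨m, hm, h⟩ => ⟨m / N, div_pos hm hN, (hiff _).2 ?_⟩⟩, ?_⟩
  · rwa [mul_div_cancel₀ _ hN.ne']
  rintro ⟨μ, hμ, h⟩
  have hstrong := (consensusPartiallyStronglyConvex_iff hG hdiff hQ μ).1 h
  obtain ⟨xs, hxs⟩ := hsol
  set A : Stack N n →L[ℝ] Stack N n := kronIdCLM G.laplacian with hA
  have hsymm : ∀ x y, ⟪A x, y⟫_ℝ = ⟪x, A y⟫_ℝ := fun x y => by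
    rw [hA, kronIdCLM_apply, inner_kronId, G.laplacian_transpose, kronIdCLM_apply]
  have hker : ∀ x, ⟪A x, x⟫_ℝ = 0 → A x = 0 := fun x hx =>
    (kronId_laplacian_eq_zero_iff hG).2 (exists_eq_consensus hG hx)
  refine ⟨xs, hxs, fun y hy => ?_, ?_, ?_⟩
  -- Both gradients are orthogonal to the feasible direction `y - xs`, so strong monotonicity forces
  -- it to vanish.
  · have hsub : kronId G.laplacian (y - xs) = 0 := by
      rw [← kronIdCLM_apply, map_sub, kronIdCLM_apply, kronIdCLM_apply, hxs.1, hy.1, sub_zero]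
    have h1 := hstrong y xs hy.1 hxs.1
    rw [inner_sub_left, hy.inner_gradient_eq_zero hdiff hsub,
      hxs.inner_gradient_eq_zero hdiff hsub, sub_zero] at h1
    have h2 : ‖y - xs‖ ^ 2 = 0 :=
      le_antisymm (nonpos_of_mul_nonpos_right h1 hμ) (sq_nonneg _)
    exact sub_eq_zero.1 (norm_eq_zero.1 (pow_eq_zero_iff two_ne_zero |>.1 h2))
  · have hmem : ∇ (stackedCost f) xs ∈ A.kerᗮ := by
      rw [Submodule.mem_orthogonal']
      exact fun v hv => hxs.inner_gradient_eq_zero hdiff hv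
    obtain ⟨w, hw⟩ := exists_apply_eq_of_mem_orthogonal_ker A hsymm hmem
    refine ⟨-w, hxs.1, ?_⟩
    rw [← kronIdCLM_apply, map_neg, ← hA, hw, add_neg_cancel]
  · obtain ⟨c, ρ, hc, hρ, hbound⟩ := exists_exponential_bound_flow hl hconv
      (gradient_lipschitz hF hl hconv hsmooth) A hsymm (inner_kronId_laplacian_self_nonneg G) hker
      hμ hstrong hα hxs.1
    exact ⟨c, ρ, hc, hρ, fun x lam hflow lams hlams t ht => hbound x lam hflow lams hlams.2 t ht⟩
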